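/- Let $n\ge 2$ and $\gamma>0$. Let $\mathbb{B}^n$ be the open unit ball of $\mathbb{R}^n$ with the hyperbolic metric $4|dx|^2/(1-|x|^2)^2$, volume $dV=\left(\frac{2}{1-|x|^2}\right)^n dx$ and Laplace–Beltrami operator $\Delta_{\mathbb H}$. For $\lambda\in\mathbb{R}$, $\zeta\in\mathbb{S}^{n-1}$, $x\in\mathbb{B}^n$ put $$e_{\lambda,\zeta}(x)=\left(\frac{1-|x|^2}{|x-\zeta|^2}\right)^{\frac{n-1}{2}+i\lambda},\qquad \mathfrak c(\lambda)=\sqrt2\,(2\pi)^{n/2}\frac{\Gamma(i\lambda)}{\Gamma(i\lambda+\frac{n-1}{2})},$$ so that $-\Delta_{\mathbb H}e_{\lambda,\zeta}=\left(\frac{(n-1)^2}{4}+\lambda^2\right)e_{\lambda,\zeta}$, and for $f\in C_0^\infty(\mathbb{B}^n)$ (complex valued) let $\widehat f(\lambda,\zeta)=\int_{\mathbb{B}^n}f\,e_{-\lambda,\zeta}\,dV$ be its Helgason–Fourier transform. For an even function $m:\mathbb{R}\to\mathbb{R}$ the operator $m\left(\sqrt{-\Delta_{\mathbb H}-\frac{(n-1)^2}{4}}\right)$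 is the Helgason–Fourier multiplier $$\left(m\left(\sqrt{-\Delta_{\mathbb H}-\tfrac{(n-1)^2}{4}}\right)f\right)(x)=\int_{\mathbb{R}}\int_{\mathbb{S}^{n-1}}m(\lambda)\,\widehat f(\lambda,\zeta)\,e_{\lambda,\zeta}(x)\,|\mathfrak c(\lambda)|^{-2}\,d\sigma(\zeta)\,d\lambda ,$$ where $\sigma$ is the surface measure of $\mathbb{S}^{n-1}$. In this sense, with $A=\sqrt{-\Delta_{\mathbb H}-\frac{(n-1)^2}{4}}$, define the fractional GJMS operator $P_\gamma$ on hyperbolic space and the operator $\widetilde P_\gamma$ by $$P_\gamma=2^{2\gamma}\frac{\left|\Gamma\left(\frac{3+2\gamma}{4}+\frac i2A\right)\right|^2}{\left|\Gamma\left(\frac{3-2\gamma}{4}+\frac i2A\right)\right|^2},\qquad \widetilde P_\gamma=\frac{\left|\Gamma\left(\gamma+\frac12+iA\right)\right|^2}{\left|\Gamma\left(\frac12+iA\right)\right|^2}$$ (with $1/\Gamma=0$ at the poles of $\Gamma$). Then on $C_0^\infty(\mathbb{B}^n)$ $$P_\gamma=\widetilde P_\gamma+\frac{\sin\gamma\pi}{\pi}\left|\Gamma\left(\gamma+\tfrac12+i\sqrt{-\Delta_{\mathbb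 H}-\tfrac{(n-1)^2}{4}}\right)\right|^2,$$ that is, for every $f\in C_0^\infty(\mathbb{B}^n)$ and every $x\in\mathbb{B}^n$ the integrals defining the three operators applied to $f$ at $x$ converge absolutely and the two sides agree at $x$. At the level of symbols, for every $\lambda\in\mathbb{R}$, $$2^{2\gamma}\frac{\left|\Gamma\left(\frac{3+2\gamma}{4}+\frac i2\lambda\right)\right|^2}{\left|\Gamma\left(\frac{3-2\gamma}{4}+\frac i2\lambda\right)\right|^2}=\frac{\left|\Gamma\left(\gamma+\frac12+i\lambda\right)\right|^2}{\left|\Gamma\left(\frac12+i\lambda\right)\right|^2}+\frac{\sin\gamma\pi}{\pi}\left|\Gamma\left(\gamma+\tfrac12+i\lambda\right)\right|^2 .$$ -/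

import Mathlib

open MeasureTheory
open scoped ContDiff

noncomputable section

/-- The open unit ball `𝔹ⁿ`, the carrier of the Poincaré ball model of hyperbolic space. -/
def hypBall (n : ℕ) : Set (EuclideanSpace ℝ (Fin n)) := Metric.ball 0 1

/-- The hyperbolic volume `dV = (2 / (1 - |x|²))ⁿ dx` on the ball. -/
def hypVolume (n : ℕ) : Measure (EuclideanSpace ℝ (Fin n)) :=
  (volume.restrict (hypBall n)).withDensity
    (fun x => ENNReal.ofReal ((2 / (1 - ‖x‖ ^ 2)) ^ n))

/-- `f ∈ C₀^∞(𝔹ⁿ)`, complex valued and extended by zero to `ℝⁿ`. -/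
structure IsTestFunction (n : ℕ) (f : EuclideanSpace ℝ (Fin n) → ℂ) : Prop where
  smooth : ContDiff ℝ ∞ f
  compact : HasCompactSupport f
  support_subset : tsupport f ⊆ hypBall n

/-- The hyperbolic plane wave
`e_{λ,ζ}(x) = (√(1 - |x|²) / |x - ζ|)^(n - 1 + 2iλ) = ((1 - |x|²) / |x - ζ|²)^((n - 1)/2 + iλ)`,
for which `-Δ_ℍ e_{λ,ζ} = ((n - 1)²/4 + λ²) e_{λ,ζ}`. -/
def planeWave (n : ℕ) (lam : ℝ) (ζ x : EuclideanSpace ℝ (Fin n)) : ℂ :=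
  (((1 - ‖x‖ ^ 2) / ‖x - ζ‖ ^ 2 : ℝ) : ℂ) ^ (((n : ℂ) - 1) / 2 + Complex.I * (lam : ℂ))

/-- The Helgason-Fourier transform `f̂(λ,ζ) = ∫ f(x) e_{-λ,ζ}(x) dV(x)`. -/
def helgasonFourier (n : ℕ) (f : EuclideanSpace ℝ (Fin n) → ℂ) (lam : ℝ)
    (ζ : EuclideanSpace ℝ (Fin n)) : ℂ :=
  ∫ x, f x * planeWave n (-lam) ζ x ∂(hypVolume n)

/-- The Harish-Chandra function `𝔠(λ) = √2 (2π)^(n/2) Γ(iλ) / Γ(iλ + (n - 1)/2)`. It has a pole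
at `λ = 0`; there the value used here is `0`, which gives `|𝔠(0)|⁻² = 0`, the correct limit. -/
def harishChandraC (n : ℕ) (lam : ℝ) : ℂ :=
  ((Real.sqrt 2 * (2 * Real.pi) ^ ((n : ℝ) / 2) : ℝ) : ℂ) *
    (Complex.Gamma (Complex.I * (lam : ℂ)) /
      Complex.Gamma (Complex.I * (lam : ℂ) + ((n : ℂ) - 1) / 2))

/-- The measure `dλ dσ(ζ)` on `ℝ × 𝕊ⁿ⁻¹`, with `σ` the (unnormalized) surface measure. -/
def spectralMeasure (n : ℕ) :
    Measure (ℝ × Metric.sphere (0 : EuclideanSpace ℝ (Fin n)) 1) :=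
  (volume : Measure ℝ).prod
    (volume : Measure (EuclideanSpace ℝ (Fin n))).toSphere

/-- The integrand `m(λ) f̂(λ,ζ) e_{λ,ζ}(x) |𝔠(λ)|⁻²` of the inverse Helgason-Fourier transform of
`m f̂`. -/
def multiplierIntegrand (n : ℕ) (m : ℝ → ℝ) (f : EuclideanSpace ℝ (Fin n) → ℂ)
    (x : EuclideanSpace ℝ (Fin n))
    (p : ℝ × Metric.sphere (0 : EuclideanSpace ℝ (Fin n)) 1) : ℂ :=
  (m p.1 : ℂ) * helgasonFourier n f p.1 (p.2 : EuclideanSpace ℝ (Fin n)) *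
    planeWave n p.1 (p.2 : EuclideanSpace ℝ (Fin n)) x *
      (((‖harishChandraC n p.1‖ ^ 2)⁻¹ : ℝ) : ℂ)

/-- For an even symbol `m`, the operator `m(√(-Δ_ℍ - (n - 1)²/4))` in terms of the
Helgason-Fourier transform: multiply `f̂(λ,ζ)` by `m(λ)` and transform back, that is
`x ↦ ∫ ∫ m(λ) f̂(λ,ζ) e_{λ,ζ}(x) |𝔠(λ)|⁻² dλ dσ(ζ)`. -/
def spectralMultiplier (n : ℕ) (m : ℝ → ℝ) (f : EuclideanSpace ℝ (Fin n) → ℂ)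
    (x : EuclideanSpace ℝ (Fin n)) : ℂ :=
  ∫ p, multiplierIntegrand n m f x p ∂(spectralMeasure n)

/-- The symbol `2^(2γ) |Γ((3 + 2γ)/4 + iλ/2)|² / |Γ((3 - 2γ)/4 + iλ/2)|²` of `P_γ`. Where the
Gamma function in the denominator has a pole, the quotient is `0`, as it should be. -/
def gjmsSymbol (γ lam : ℝ) : ℝ :=
  (2 : ℝ) ^ (2 * γ) *
    (‖Complex.Gamma ((3 + 2 * (γ : ℂ)) / 4 + Complex.I / 2 * (lam : ℂ))‖ ^ 2 /
      ‖Complex.Gamma ((3 - 2 * (γ : ℂ)) / 4 + Complex.I / 2 * (lam : ℂ))‖ ^ 2)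

/-- The symbol `|Γ(γ + 1/2 + iλ)|² / |Γ(1/2 + iλ)|²` of `P̃_γ`. -/
def tildeGjmsSymbol (γ lam : ℝ) : ℝ :=
  ‖Complex.Gamma ((γ : ℂ) + 1 / 2 + Complex.I * (lam : ℂ))‖ ^ 2 /
    ‖Complex.Gamma (1 / 2 + Complex.I * (lam : ℂ))‖ ^ 2

/-- The symbol `|Γ(γ + 1/2 + iλ)|²`. -/
def gammaSqSymbol (γ lam : ℝ) : ℝ :=
  ‖Complex.Gamma ((γ : ℂ) + 1 / 2 + Complex.I * (lam : ℂ))‖ ^ 2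

/-- The fractional GJMS operator `P_γ` on hyperbolic space. -/
def fractionalGJMS (n : ℕ) (γ : ℝ) :
    (EuclideanSpace ℝ (Fin n) → ℂ) → EuclideanSpace ℝ (Fin n) → ℂ :=
  spectralMultiplier n (gjmsSymbol γ)

/-- The operator `P̃_γ`. -/
def tildeGJMS (n : ℕ) (γ : ℝ) :
    (EuclideanSpace ℝ (Fin n) → ℂ) → EuclideanSpace ℝ (Fin n) → ℂ :=
  spectralMultiplier n (tildeGjmsSymbol γ)

/-- The operator `|Γ(γ + 1/2 + i √(-Δ_ℍ - (n - 1)²/4))|²`. -/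
def gammaSqOperator (n : ℕ) (γ : ℝ) :
    (EuclideanSpace ℝ (Fin n) → ℂ) → EuclideanSpace ℝ (Fin n) → ℂ :=
  spectralMultiplier n (gammaSqSymbol γ)

end

/-! The symbol identity combines two Gamma formulas. With `s = (1+2γ)/4 + iλ/2`, reflection turns
`1/Γ(1 - s̄)` into `Γ(s̄) sin(π s̄)/π`, and duplication merges `Γ(s)Γ(s+1/2)` into `Γ(2s)`, where
`2s = γ + 1/2 + iλ`. Hence the symbol of `P_γ` is `|Γ(2s)|² (cosh πλ + sin γπ)/π`, and `cosh(πλ)/π =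
|Γ(1/2+iλ)|⁻²` (`gjmsSymbol_eq`).

The operator identity then follows by linearity, once the integrals converge absolutely
(`integrable_multiplierIntegrand`). The symbols and `|𝔠|⁻²` are continuous with polynomial growth
(`hasPolyGrowth_Gamma_ratio_sq`), and the plane wave at fixed `x` is bounded. The transform `f̂`
decays faster than any power of `λ`, uniformly in `ζ`: it is an oscillatory integral whose phase
`log((1-|x|²)/|x-ζ|²)` has no critical point, so one can integrate by parts repeatedly
(`exists_pow_mul_norm_integral_oscFactor_le`). -/

/-! ### Comparison of Gamma on vertical lines. -/

theorem norm_betaIntegral_add_mul_I_le {a : ℝ} (v : ℂ) (t : ℝ) :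
    ‖Complex.betaIntegral ((a : ℂ) + Complex.I * t) v‖ ≤
      ∫ x : ℝ in 0..1, ‖(x : ℂ) ^ ((a : ℂ) - 1) * (1 - (x : ℂ)) ^ (v - 1)‖ := by
  refine (intervalIntegral.norm_integral_le_integral_norm zero_le_one).trans_eq ?_
  refine intervalIntegral.integral_congr_ae (Filter.Eventually.of_forall fun x hx => ?_)
  rw [Set.uIoc_of_le zero_le_one] at hx
  simp only [norm_mul, Complex.norm_cpow_eq_rpow_re_of_pos hx.1]
  simp

/-- From `Γ(a+it) Γ(b-a) = Γ(b+it) B(a+it, b-a)`: the modulus of the Beta integrand does not depend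
on `t`. -/
theorem exists_norm_Gamma_add_mul_I_le {a b : ℝ} (ha : 0 < a) (hab : a < b) :
    ∃ C : ℝ, 0 ≤ C ∧ ∀ t : ℝ, ‖Complex.Gamma ((a : ℂ) + Complex.I * t)‖ ≤
      C * ‖Complex.Gamma ((b : ℂ) + Complex.I * t)‖ := by
  have hd : 0 < (((b - a : ℝ) : ℂ)).re := by simpa using hab
  have hΓ : 0 < ‖Complex.Gamma ((b - a : ℝ) : ℂ)‖ :=
    norm_pos_iff.2 (Complex.Gamma_ne_zero_of_re_pos hd)
  set B := ∫ x : ℝ in 0..1,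
    ‖(x : ℂ) ^ ((a : ℂ) - 1) * (1 - (x : ℂ)) ^ (((b - a : ℝ) : ℂ) - 1)‖
  have hB0 : 0 ≤ B := intervalIntegral.integral_nonneg zero_le_one fun _ _ => norm_nonneg _
  refine ⟨B / ‖Complex.Gamma ((b - a : ℝ) : ℂ)‖, by positivity, fun t => ?_⟩
  have h := Complex.Gamma_mul_Gamma_eq_betaIntegral
    (s := (a : ℂ) + Complex.I * t) (by simpa using ha) hd
  have h2 : (a : ℂ) + Complex.I * t + ((b - a : ℝ) : ℂ) = (b : ℂ) + Complex.I * t := by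
    push_cast; ring
  rw [h2] at h
  have h3 := congrArg norm h
  rw [norm_mul, norm_mul] at h3
  rw [div_mul_eq_mul_div, le_div_iff₀ hΓ, h3, mul_comm]
  exact mul_le_mul_of_nonneg_right (norm_betaIntegral_add_mul_I_le _ t) (norm_nonneg _)

/-- Shifting the real part by a natural number costs at most a polynomial factor. -/
theorem exists_norm_Gamma_add_nat_le {b : ℝ} (hb : 0 ≤ b) (N : ℕ) :
    ∃ C : ℝ, 0 ≤ C ∧ ∀ t : ℝ, (b = 0 → t ≠ 0) →
      ‖Complex.Gamma (((b + N : ℝ) : ℂ) + Complex.I * t)‖ ≤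
        C * (1 + |t|) ^ N * ‖Complex.Gamma ((b : ℂ) + Complex.I * t)‖ := by
  induction N with
  | zero => exact ⟨1, zero_le_one, fun t _ => by simp⟩
  | succ N ih =>
    obtain ⟨C, hC, h⟩ := ih
    refine ⟨(b + N + 1) * C, by positivity, fun t ht => ?_⟩
    -- The sum vanishes only for `b = N = t = 0`, which `ht` excludes.
    have hne : ((b + N : ℝ) : ℂ) + Complex.I * t ≠ 0 := by
      intro h0
      have h1 := congrArg Complex.re h0
      have h2 := congrArg Complex.im h0
      simp only [Complex.add_re, Complex.ofReal_re, Complex.mul_re, Complex.I_re, Complex.I_im,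
        Complex.ofReal_im, Complex.add_im, Complex.mul_im, Complex.zero_re, Complex.zero_im] at h1 h2
      have hN : (0 : ℝ) ≤ N := Nat.cast_nonneg N
      exact ht (by linarith) (by linarith)
    have e : ((b + (N + 1 : ℕ) : ℝ) : ℂ) + Complex.I * t =
        ((b + N : ℝ) : ℂ) + Complex.I * t + 1 := by push_cast; ring
    rw [e, Complex.Gamma_add_one _ hne, norm_mul]
    have hn : ‖((b + N : ℝ) : ℂ) + Complex.I * t‖ ≤ (b + N + 1) * (1 + |t|) := by
      refine (norm_add_le _ _).trans ?_
      rw [norm_mul, Complex.norm_I, Complex.norm_real, Complex.norm_real, Real.norm_eq_abs,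
        Real.norm_eq_abs, abs_of_nonneg (by positivity)]
      have : 0 ≤ (b + N) * |t| := by positivity
      linarith
    calc _ ≤ ((b + N + 1) * (1 + |t|)) *
          (C * (1 + |t|) ^ N * ‖Complex.Gamma ((b : ℂ) + Complex.I * t)‖) :=
          mul_le_mul hn (h t ht) (norm_nonneg _) (by positivity)
      _ = _ := by ring

/-- A substitute for Stirling: pass from `a` up to some `b + N > a` by the Beta bound, then down to
`b` by the functional equation. -/
theorem exists_norm_Gamma_le_pow_mul {a b : ℝ} (ha : 0 < a) (hb : 0 ≤ b) :
    ∃ (C : ℝ) (N : ℕ), 0 ≤ C ∧ ∀ t : ℝ, (b = 0 → t ≠ 0) →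
      ‖Complex.Gamma ((a : ℂ) + Complex.I * t)‖ ≤
        C * (1 + |t|) ^ N * ‖Complex.Gamma ((b : ℂ) + Complex.I * t)‖ := by
  obtain ⟨N, hN⟩ := exists_nat_gt (a - b)
  obtain ⟨C, hC, h⟩ := exists_norm_Gamma_add_mul_I_le ha (show a < b + N by linarith)
  obtain ⟨D, hD, h'⟩ := exists_norm_Gamma_add_nat_le hb N
  refine ⟨C * D, N, by positivity, fun t ht => (h t).trans ?_⟩
  calc _ ≤ C * (D * (1 + |t|) ^ N * ‖Complex.Gamma ((b : ℂ) + Complex.I * t)‖) :=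
        mul_le_mul_of_nonneg_left (h' t ht) hC
    _ = _ := by ring

theorem continuous_Gamma_add_I_mul {a : ℝ} (ha : 0 < a) :
    Continuous fun t : ℝ => Complex.Gamma ((a : ℂ) + Complex.I * t) := by
  rw [continuous_iff_continuousAt]
  intro t
  have h : ContinuousAt Complex.Gamma ((a : ℂ) + Complex.I * t) := by
    refine (Complex.differentiableAt_Gamma _ fun m hm => ?_).continuousAt
    have := congrArg Complex.re hm
    simp at this
    have hm : (0 : ℝ) ≤ m := Nat.cast_nonneg m
    linarith
  exact ContinuousAt.comp (f := fun t : ℝ => (a : ℂ) + Complex.I * t) h (by fun_prop)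

/-- Since `1/Γ` is entire, poles do no harm; `a = 0` is needed for `|𝔠|⁻²`. -/
theorem continuous_Gamma_inv_add_I_mul (a : ℝ) :
    Continuous fun t : ℝ => (Complex.Gamma ((a : ℂ) + Complex.I * t))⁻¹ :=
  Complex.differentiable_one_div_Gamma.continuous.comp
    (by fun_prop : Continuous fun t : ℝ => (a : ℂ) + Complex.I * t)

/-! ### The symbol identity. -/

/-- On the line `Re s = 1/2` one has `1 - s = s̄`, so reflection yields `|Γ(s)|²` directly. -/
theorem norm_Gamma_half_sq (t : ℝ) :
    ‖Complex.Gamma (1 / 2 + Complex.I * (t : ℂ))‖ ^ 2 = Real.pi / Real.cosh (Real.pi * t) := by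
  have h := Complex.Gamma_mul_Gamma_one_sub (1 / 2 + Complex.I * (t : ℂ))
  have e : 1 - (1 / 2 + Complex.I * (t : ℂ)) =
      (starRingEnd ℂ) (1 / 2 + Complex.I * (t : ℂ)) := by
    simp [Complex.ext_iff]; norm_num
  have e2 : Complex.sin (Real.pi * (1 / 2 + Complex.I * (t : ℂ))) =
      (Real.cosh (Real.pi * t) : ℝ) := by
    rw [show (Real.pi : ℂ) * (1 / 2 + Complex.I * (t : ℂ)) =
      ((Real.pi * t : ℝ) : ℂ) * Complex.I + Real.pi / 2 by push_cast; ring,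
      Complex.sin_add_pi_div_two, Complex.cos_mul_I, Complex.ofReal_cosh]
  rw [e, e2, Complex.Gamma_conj, Complex.mul_conj, ← Complex.ofReal_div] at h
  rw [← Complex.normSq_eq_norm_sq]
  exact_mod_cast h

theorem norm_sin_sq (z : ℂ) :
    ‖Complex.sin z‖ ^ 2 = (Real.cosh (2 * z.im) - Real.cos (2 * z.re)) / 2 := by
  have h : Complex.sin z = ((Real.sin z.re * Real.cosh z.im : ℝ) : ℂ) +
      ((Real.cos z.re * Real.sinh z.im : ℝ) : ℂ) * Complex.I := by
    rw [Complex.sin_eq]; push_cast; ring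
  rw [h, ← Complex.normSq_eq_norm_sq, Complex.normSq_add_mul_I, Real.cosh_two_mul,
    Real.cos_two_mul]
  have h1 := Real.cosh_sq z.im
  have h2 := Real.sin_sq_add_cos_sq z.re
  have h3 : Real.sin z.re ^ 2 = 1 - Real.cos z.re ^ 2 := by linarith
  rw [mul_pow, mul_pow, h1, h3]; ring

/-- Inverting the reflection formula keeps it valid at the poles of `Γ(1 - s)`, where both sides are
`0`. -/
theorem norm_inv_Gamma_one_sub {s : ℂ} (hs : Complex.Gamma s ≠ 0) :
    ‖Complex.Gamma (1 - s)‖⁻¹ = ‖Complex.Gamma s‖ * ‖Complex.sin (Real.pi * s)‖ / Real.pi := by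
  have h := congrArg (fun z => ‖z‖⁻¹) (Complex.Gamma_mul_Gamma_one_sub s)
  simp only [norm_mul, norm_div, mul_inv, inv_div, Complex.norm_real, Real.norm_eq_abs,
    abs_of_pos Real.pi_pos] at h
  have h0 : ‖Complex.Gamma s‖ ≠ 0 := norm_ne_zero_iff.2 hs
  rw [mul_div_assoc, ← h, mul_inv_cancel_left₀ h0]

theorem gjmsSymbol_eq {γ : ℝ} (hγ : 0 < γ) (lam : ℝ) :
    gjmsSymbol γ lam =
      tildeGjmsSymbol γ lam + Real.sin (γ * Real.pi) / Real.pi * gammaSqSymbol γ lam := by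
  set s : ℂ := (1 + 2 * (γ : ℂ)) / 4 + Complex.I / 2 * (lam : ℂ) with hs
  have hre : s.re = (1 + 2 * γ) / 4 := by
    simp [hs]
  have him : s.im = lam / 2 := by
    simp [hs]; ring
  have hpos : 0 < s.re := by rw [hre]; positivity
  have hpos2 : 0 < ((starRingEnd ℂ) s).re := by simpa using hpos
  have e1 : (3 + 2 * (γ : ℂ)) / 4 + Complex.I / 2 * (lam : ℂ) = s + 1 / 2 := by
    rw [hs]; ring
  have e2 : (3 - 2 * (γ : ℂ)) / 4 + Complex.I / 2 * (lam : ℂ) = 1 - (starRingEnd ℂ) s := by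
    apply Complex.ext
    · simp [hre]; ring
    · simp [him]; ring
  have e3 : (γ : ℂ) + 1 / 2 + Complex.I * (lam : ℂ) = 2 * s := by rw [hs]; ring
  have hdup := congrArg norm (Complex.Gamma_mul_Gamma_add_half s)
  have hpow : ‖(2 : ℂ) ^ (1 - 2 * s)‖ = (2 : ℝ) ^ (1 / 2 - γ) := by
    have := Complex.norm_cpow_eq_rpow_re_of_pos (x := 2) two_pos (1 - 2 * s)
    rw [Complex.ofReal_ofNat] at this
    rw [this]; congr 1; simp [hre]; ring
  rw [norm_mul, norm_mul, norm_mul, hpow, Complex.norm_real, Real.norm_eq_abs,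
    abs_of_nonneg (Real.sqrt_nonneg _)] at hdup
  have hrefl := norm_inv_Gamma_one_sub (Complex.Gamma_ne_zero_of_re_pos hpos2)
  have hsin : ‖Complex.sin (Real.pi * (starRingEnd ℂ) s)‖ ^ 2 =
      (Real.cosh (Real.pi * lam) + Real.sin (γ * Real.pi)) / 2 := by
    rw [norm_sin_sq]
    have a1 : 2 * ((Real.pi : ℂ) * (starRingEnd ℂ) s).im = -(Real.pi * lam) := by
      simp [him]; ring
    have a2 : 2 * ((Real.pi : ℂ) * (starRingEnd ℂ) s).re = γ * Real.pi + Real.pi / 2 := by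
      simp [hre]; ring
    rw [a1, a2, Real.cosh_neg, Real.cos_add_pi_div_two]; ring
  rw [Complex.Gamma_conj, RCLike.norm_conj] at hrefl
  unfold gjmsSymbol tildeGjmsSymbol gammaSqSymbol
  rw [norm_Gamma_half_sq, e1, e2, e3, div_eq_mul_inv, ← inv_pow, hrefl]
  have hc := Real.cosh_pos (Real.pi * lam)
  have hp := Real.pi_pos
  -- The normalization `2^(2γ)` cancels the `γ`-dependence of the duplication factor; the remaining
  -- `2` cancels the `1/2` in `|sin|²`.
  have h2 : (2 : ℝ) ^ (2 * γ) * ((2 : ℝ) ^ (1 / 2 - γ)) ^ 2 = 2 := by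
    rw [← Real.rpow_natCast, ← Real.rpow_mul two_pos.le, ← Real.rpow_add two_pos,
      show 2 * γ + (1 / 2 - γ) * ((2 : ℕ) : ℝ) = 1 by push_cast; ring, Real.rpow_one]
  calc _ = (2 : ℝ) ^ (2 * γ) * (‖Complex.Gamma s‖ * ‖Complex.Gamma (s + 1 / 2)‖) ^ 2 *
        ‖Complex.sin (Real.pi * (starRingEnd ℂ) s)‖ ^ 2 / Real.pi ^ 2 := by ring
    _ = ((2 : ℝ) ^ (2 * γ) * ((2 : ℝ) ^ (1 / 2 - γ)) ^ 2) * ‖Complex.Gamma (2 * s)‖ ^ 2 *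
        Real.sqrt Real.pi ^ 2 *
        ((Real.cosh (Real.pi * lam) + Real.sin (γ * Real.pi)) / 2) / Real.pi ^ 2 := by
      rw [hdup, hsin]; ring
    _ = _ := by
      rw [h2, Real.sq_sqrt hp.le]; field_simp

/-! ### Continuity and polynomial growth of the symbols and of the Plancherel density. -/

theorem gammaSqSymbol_eq (γ lam : ℝ) : gammaSqSymbol γ lam =
    ‖Complex.Gamma (((γ + 1 / 2 : ℝ) : ℂ) + Complex.I * lam)‖ ^ 2 := by
  simp [gammaSqSymbol]

theorem tildeGjmsSymbol_eq (γ lam : ℝ) : tildeGjmsSymbol γ lam =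
    ‖Complex.Gamma (((γ + 1 / 2 : ℝ) : ℂ) + Complex.I * lam)‖ ^ 2 *
      ‖(Complex.Gamma (((1 / 2 : ℝ) : ℂ) + Complex.I * lam))⁻¹‖ ^ 2 := by
  simp [tildeGjmsSymbol, div_eq_mul_inv]

theorem continuous_gammaSqSymbol {γ : ℝ} (hγ : 0 < γ) : Continuous (gammaSqSymbol γ) := by
  rw [funext (gammaSqSymbol_eq γ)]
  exact (continuous_Gamma_add_I_mul (by positivity)).norm.pow 2

theorem continuous_tildeGjmsSymbol {γ : ℝ} (hγ : 0 < γ) : Continuous (tildeGjmsSymbol γ) := by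
  rw [funext (tildeGjmsSymbol_eq γ)]
  exact ((continuous_Gamma_add_I_mul (by positivity)).norm.pow 2).mul
    ((continuous_Gamma_inv_add_I_mul _).norm.pow 2)

/-- Symbols of at most polynomial growth. -/
def HasPolyGrowth (m : ℝ → ℝ) : Prop :=
  ∃ (C : ℝ) (N : ℕ), 0 ≤ C ∧ ∀ t, |m t| ≤ C * (1 + |t|) ^ N

theorem HasPolyGrowth.mul {m₁ m₂ : ℝ → ℝ} (h₁ : HasPolyGrowth m₁) (h₂ : HasPolyGrowth m₂) :
    HasPolyGrowth fun t => m₁ t * m₂ t := by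
  obtain ⟨C, N, hC, h⟩ := h₁
  obtain ⟨D, M, hD, h'⟩ := h₂
  refine ⟨C * D, N + M, by positivity, fun t => ?_⟩
  rw [abs_mul]
  calc _ ≤ (C * (1 + |t|) ^ N) * (D * (1 + |t|) ^ M) :=
        mul_le_mul (h t) (h' t) (abs_nonneg _) (by positivity)
    _ = _ := by ring

theorem hasPolyGrowth_Gamma_ratio_sq {a b : ℝ} (ha : 0 < a) (hb : 0 ≤ b) :
    HasPolyGrowth fun t => ‖Complex.Gamma ((a : ℂ) + Complex.I * t)‖ ^ 2 *
      ‖(Complex.Gamma ((b : ℂ) + Complex.I * t))⁻¹‖ ^ 2 := by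
  obtain ⟨C, N, hC, h⟩ := exists_norm_Gamma_le_pow_mul ha hb
  refine ⟨C ^ 2, N * 2, by positivity, fun t => ?_⟩
  beta_reduce
  rw [← mul_pow, abs_of_nonneg (sq_nonneg _), pow_mul, ← mul_pow, norm_inv, ← div_eq_mul_inv]
  -- This happens only at the pole `b = t = 0`, where the default value `0` of `Γ` makes the left
  -- side vanish.
  by_cases h0 : Complex.Gamma ((b : ℂ) + Complex.I * t) = 0
  · rw [h0, norm_zero, div_zero, zero_pow two_ne_zero]; positivity
  · refine pow_le_pow_left₀ (by positivity) ?_ 2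
    rw [div_le_iff₀ (norm_pos_iff.2 h0)]
    refine h t ?_
    rintro rfl rfl
    simp at h0

theorem hasPolyGrowth_tildeGjmsSymbol {γ : ℝ} (hγ : 0 < γ) :
    HasPolyGrowth (tildeGjmsSymbol γ) := by
  rw [funext (tildeGjmsSymbol_eq γ)]
  exact hasPolyGrowth_Gamma_ratio_sq (by positivity) (by positivity)

/-- This symbol is the one of `P̃_γ` times `π / cosh(πλ) ≤ π`. -/
theorem hasPolyGrowth_gammaSqSymbol {γ : ℝ} (hγ : 0 < γ) : HasPolyGrowth (gammaSqSymbol γ) := by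
  have h : gammaSqSymbol γ = fun t => tildeGjmsSymbol γ t *
      ‖Complex.Gamma (1 / 2 + Complex.I * (t : ℂ))‖ ^ 2 := by
    funext t
    have h0 : ‖Complex.Gamma (1 / 2 + Complex.I * (t : ℂ))‖ ≠ 0 :=
      norm_ne_zero_iff.2 (Complex.Gamma_ne_zero_of_re_pos (by simp))
    rw [tildeGjmsSymbol, gammaSqSymbol, div_mul_cancel₀ _ (pow_ne_zero 2 h0)]
  rw [h]
  refine (hasPolyGrowth_tildeGjmsSymbol hγ).mul ⟨Real.pi, 0, Real.pi_pos.le, fun t => ?_⟩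
  beta_reduce
  rw [abs_of_nonneg (sq_nonneg _), norm_Gamma_half_sq, pow_zero, mul_one]
  exact div_le_self Real.pi_pos.le (Real.one_le_cosh _)

/-- Puts `|𝔠|⁻²` in the form of the Gamma ratio with `a = (n-1)/2` and `b = 0`. -/
theorem inv_norm_harishChandraC_sq (n : ℕ) (lam : ℝ) :
    (‖harishChandraC n lam‖ ^ 2)⁻¹ =
      ((Real.sqrt 2 * (2 * Real.pi) ^ ((n : ℝ) / 2)) ^ 2)⁻¹ *
        (‖Complex.Gamma (((((n : ℝ) - 1) / 2 : ℝ) : ℂ) + Complex.I * lam)‖ ^ 2 *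
          ‖(Complex.Gamma (((0 : ℝ) : ℂ) + Complex.I * lam))⁻¹‖ ^ 2) := by
  unfold harishChandraC
  rw [norm_mul, norm_div, Complex.norm_real, Real.norm_eq_abs, norm_inv,
    show Complex.I * (lam : ℂ) + ((n : ℂ) - 1) / 2 =
      ((((n : ℝ) - 1) / 2 : ℝ) : ℂ) + Complex.I * lam by push_cast; ring,
    show ((0 : ℝ) : ℂ) + Complex.I * lam = Complex.I * lam by simp,
    mul_pow, sq_abs, mul_inv, div_pow, inv_div, inv_pow, div_eq_mul_inv (_ ^ 2)]

theorem hasPolyGrowth_inv_norm_harishChandraC_sq {n : ℕ} (hn : 2 ≤ n) :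
    HasPolyGrowth fun t => (‖harishChandraC n t‖ ^ 2)⁻¹ := by
  simp only [inv_norm_harishChandraC_sq]
  have hn' : (2 : ℝ) ≤ n := by exact_mod_cast hn
  refine HasPolyGrowth.mul ⟨_, 0, abs_nonneg _, fun t => (by rw [pow_zero, mul_one])⟩
    (hasPolyGrowth_Gamma_ratio_sq (by linarith) le_rfl)

theorem continuous_inv_norm_harishChandraC_sq {n : ℕ} (hn : 2 ≤ n) :
    Continuous fun t => (‖harishChandraC n t‖ ^ 2)⁻¹ := by
  simp only [inv_norm_harishChandraC_sq]
  have hn' : (2 : ℝ) ≤ n := by exact_mod_cast hn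
  exact continuous_const.mul (((continuous_Gamma_add_I_mul (by linarith)).norm.pow 2).mul
    ((continuous_Gamma_inv_add_I_mul _).norm.pow 2))

/-! ### Oscillatory integrals without stationary points. -/

/-- The oscillatory factor `exp(-iλψ)`. -/
noncomputable def oscFactor {X : Type*} (ψ : X → ℝ) (lam : ℝ) (q : X) : ℂ :=
  Complex.exp (-(Complex.I * lam) * (ψ q : ℂ))

theorem norm_oscFactor {X : Type*} (ψ : X → ℝ) (lam : ℝ) (q : X) :
    ‖oscFactor ψ lam q‖ = 1 := by
  rw [oscFactor, Complex.norm_exp]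
  simp

section OscillatoryIntegral

variable {P E ι : Type*} [NormedAddCommGroup P] [NormedSpace ℝ P]
  [NormedAddCommGroup E] [NormedSpace ℝ E]

/-- The transpose `G ↦ ∑ⱼ ∂ⱼ (vⱼ G)` of minus the derivation `∑ⱼ vⱼ ∂ⱼ` in the second variable. -/
noncomputable def transposeField [Fintype ι] (e : ι → E) (v : ι → P × E → ℝ) (G : P × E → ℂ) (p : P × E) : ℂ :=
  ∑ j, fderiv ℝ (fun q => G q * (v j q : ℂ)) p (0, e j)

theorem contDiff_mul_ofReal {X : Type*} [NormedAddCommGroup X] [NormedSpace ℝ X] {G : X → ℂ}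
    {w : X → ℝ} (hG : ContDiff ℝ ∞ G) (hw : ContDiff ℝ ∞ w) :
    ContDiff ℝ ∞ fun q => G q * (w q : ℂ) :=
  hG.mul (Complex.ofRealCLM.contDiff.comp hw)

theorem contDiff_transposeField [Fintype ι] (e : ι → E) {v : ι → P × E → ℝ}
    (hv : ∀ j, ContDiff ℝ ∞ (v j)) {G : P × E → ℂ} (hG : ContDiff ℝ ∞ G) :
    ContDiff ℝ ∞ (transposeField e v G) := by
  refine ContDiff.sum fun j _ => ?_
  exact ((contDiff_mul_ofReal hG (hv j)).fderiv_right (m := ∞) (by simp)).clm_apply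
    contDiff_const

theorem transposeField_eq_zero [Fintype ι] (e : ι → E) (v : ι → P × E → ℝ) {G : P × E → ℂ} {R : ℝ}
    (hR : ∀ p x, R < ‖x‖ → G (p, x) = 0) (p : P) (x : E) (hx : R < ‖x‖) :
    transposeField e v G (p, x) = 0 := by
  refine Finset.sum_eq_zero fun j _ => ?_
  have hev : (fun q => G q * (v j q : ℂ)) =ᶠ[nhds (p, x)] fun _ => 0 := by
    have ho : IsOpen {q : P × E | R < ‖q.2‖} := isOpen_lt continuous_const (by fun_prop)
    filter_upwards [ho.mem_nhds hx] with q hq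
    rw [show q = (q.1, q.2) from rfl, hR q.1 q.2 hq, zero_mul]
  rw [hev.fderiv_eq]
  simp

theorem fderiv_comp_prodMk {F : Type*} [NormedAddCommGroup F] [NormedSpace ℝ F] {a : P × E → F}
    (ha : Differentiable ℝ a) (p : P) (x u : E) :
    fderiv ℝ (fun y => a (p, y)) x u = fderiv ℝ a (p, x) (0, u) := by
  have h := (ha (p, x)).hasFDerivAt.comp x (hasFDerivAt_prodMk_right (𝕜 := ℝ) p x)
  have h2 : fderiv ℝ (fun y => a (p, y)) x = _ := h.fderiv
  rw [h2]
  simp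

variable {ψ : P × E → ℝ}

theorem contDiff_oscFactor (hψ : ContDiff ℝ ∞ ψ) (lam : ℝ) :
    ContDiff ℝ ∞ (oscFactor ψ lam) :=
  (contDiff_const.mul (Complex.ofRealCLM.contDiff.comp hψ)).cexp

theorem fderiv_oscFactor (hψ : ContDiff ℝ ∞ ψ) (lam : ℝ) (q u : P × E) :
    fderiv ℝ (oscFactor ψ lam) q u =
      -(Complex.I * lam) * (fderiv ℝ ψ q u : ℂ) * oscFactor ψ lam q := by
  have h1 : HasFDerivAt ψ (fderiv ℝ ψ q) q := (hψ.differentiable (by simp) q).hasFDerivAt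
  have h2 := ((Complex.ofRealCLM.hasFDerivAt.comp q h1).const_mul (-(Complex.I * lam))).cexp
  have h3 : fderiv ℝ (oscFactor ψ lam) q = _ := h2.fderiv
  rw [h3]
  simp [oscFactor]
  ring

variable [MeasurableSpace E] [BorelSpace E] [FiniteDimensional ℝ E] (μ : Measure E)
  [μ.IsAddHaarMeasure]

theorem integrable_of_eq_zero_of_lt_norm {F : Type*} [NormedAddCommGroup F] {h : E → F} {R : ℝ}
    (hc : Continuous h) (hR : ∀ x, R < ‖x‖ → h x = 0) : Integrable h μ := by
  have := FiniteDimensional.proper ℝ E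
  refine hc.integrable_of_hasCompactSupport
    (HasCompactSupport.intro (isCompact_closedBall (0 : E) R) fun x hx => hR x ?_)
  simpa using hx

/-- With `X = ∑ vⱼ ∂ⱼ` and `Xψ = 1` wherever `G` is nonzero, `X e^{-iλψ} = -iλ e^{-iλψ}` there;
integration by parts moves `X` onto `G`. -/
theorem I_mul_integral_mul_oscFactor [Fintype ι] {e : ι → E} {v : ι → P × E → ℝ} {R : ℝ}
    (hψ : ContDiff ℝ ∞ ψ) (hv : ∀ j, ContDiff ℝ ∞ (v j)) {p : P}
    (hX : ∀ x, ‖x‖ ≤ R → ∑ j, v j (p, x) * fderiv ℝ ψ (p, x) (0, e j) = 1)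
    {G : P × E → ℂ} (hG : ContDiff ℝ ∞ G) (hR : ∀ p x, R < ‖x‖ → G (p, x) = 0) (lam : ℝ) :
    (Complex.I * lam) * ∫ x, G (p, x) * oscFactor ψ lam (p, x) ∂μ =
      ∫ x, transposeField e v G (p, x) * oscFactor ψ lam (p, x) ∂μ := by
  have hE := contDiff_oscFactor hψ lam
  have hGv : ∀ j, ContDiff ℝ ∞ fun q => G q * (v j q : ℂ) := fun j =>
    contDiff_mul_ofReal hG (hv j)
  have hs : ContDiff ℝ ∞ fun y : E => (p, y) := contDiff_prodMk_right p
  have hEs := hE.comp hs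
  have hGvs := fun j => (hGv j).comp hs
  have hzero : ∀ j x, R < ‖x‖ → G (p, x) * (v j (p, x) : ℂ) = 0 := fun j x hx => by
    rw [hR p x hx, zero_mul]
  have hdE : ∀ j, Continuous fun x => fderiv ℝ (oscFactor ψ lam) (p, x) (0, e j) := fun j =>
    ((hE.continuous_fderiv (by simp)).comp hs.continuous).clm_apply continuous_const
  have hdG : ∀ j, Continuous fun x => fderiv ℝ (fun q => G q * (v j q : ℂ)) (p, x) (0, e j) :=
    fun j => (((hGv j).continuous_fderiv (by simp)).comp hs.continuous).clm_apply continuous_const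
  have hdG0 : ∀ j x, R < ‖x‖ → fderiv ℝ (fun q => G q * (v j q : ℂ)) (p, x) (0, e j) = 0 := by
    intro j x hx
    have := transposeField_eq_zero (fun _ : Unit => e j) (fun _ => v j) hR p x hx
    simpa [transposeField] using this
  have i1 : ∀ j, Integrable (fun x => fderiv ℝ (fun q => G q * (v j q : ℂ)) (p, x) (0, e j) *
      oscFactor ψ lam (p, x)) μ := fun j =>
    integrable_of_eq_zero_of_lt_norm μ ((hdG j).mul hEs.continuous) fun x hx => by
      rw [hdG0 j x hx, zero_mul]
  have i2 : ∀ j, Integrable (fun x => (G (p, x) * (v j (p, x) : ℂ)) *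
      fderiv ℝ (oscFactor ψ lam) (p, x) (0, e j)) μ := fun j =>
    integrable_of_eq_zero_of_lt_norm μ ((hGvs j).continuous.mul (hdE j)) fun x hx => by
      rw [hzero j x hx, zero_mul]
  have i3 : ∀ j, Integrable (fun x => (G (p, x) * (v j (p, x) : ℂ)) *
      oscFactor ψ lam (p, x)) μ := fun j =>
    integrable_of_eq_zero_of_lt_norm μ ((hGvs j).continuous.mul hEs.continuous) fun x hx => by
      rw [hzero j x hx, zero_mul]
  have hparts : ∀ j, ∫ x, (G (p, x) * (v j (p, x) : ℂ)) *
      fderiv ℝ (oscFactor ψ lam) (p, x) (0, e j) ∂μ =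
      -∫ x, fderiv ℝ (fun q => G q * (v j q : ℂ)) (p, x) (0, e j) *
        oscFactor ψ lam (p, x) ∂μ := by
    intro j
    have d1 := fun x => fderiv_comp_prodMk (hE.differentiable (by simp)) p x (e j)
    have d2 := fun x => fderiv_comp_prodMk ((hGv j).differentiable (by simp)) p x (e j)
    simp only [← d1, ← d2]
    refine integral_mul_fderiv_eq_neg_fderiv_mul_of_integrable ?_ ?_ (i3 j)
      (fun x _ => (hGvs j).differentiable (by simp) x) (fun x _ => hEs.differentiable (by simp) x)
    · simpa only [d2] using i1 j
    · simpa only [d1] using i2 j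
  have hsum : ∑ j, ∫ x, (G (p, x) * (v j (p, x) : ℂ)) *
      fderiv ℝ (oscFactor ψ lam) (p, x) (0, e j) ∂μ =
      -(Complex.I * lam) * ∫ x, G (p, x) * oscFactor ψ lam (p, x) ∂μ := by
    rw [← integral_finsetSum _ fun j _ => i2 j, ← integral_const_mul]
    refine integral_congr_ae (Filter.Eventually.of_forall fun x => ?_)
    by_cases hx : R < ‖x‖
    · simp [hR p x hx]
    · have h1 : ((∑ j, v j (p, x) * fderiv ℝ ψ (p, x) (0, e j) : ℝ) : ℂ) = 1 := by
        rw [hX x (not_lt.1 hx), Complex.ofReal_one]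
      push_cast at h1
      simp only [fderiv_oscFactor hψ]
      calc _ = (∑ j, (v j (p, x) : ℂ) * (fderiv ℝ ψ (p, x) (0, e j) : ℂ)) *
            (-(Complex.I * lam) * (G (p, x) * oscFactor ψ lam (p, x))) := by
            rw [Finset.sum_mul]
            exact Finset.sum_congr rfl fun j _ => by ring
        _ = _ := by rw [h1, one_mul]
  have hfin : ∫ x, transposeField e v G (p, x) * oscFactor ψ lam (p, x) ∂μ =
      ∑ j, ∫ x, fderiv ℝ (fun q => G q * (v j q : ℂ)) (p, x) (0, e j) *
        oscFactor ψ lam (p, x) ∂μ := by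
    rw [← integral_finsetSum _ fun j _ => i1 j]
    simp only [transposeField, Finset.sum_mul]
  rw [hfin]
  simp only [hparts, Finset.sum_neg_distrib] at hsum
  linear_combination hsum

/-- Rapid decay, uniform in the parameter, of oscillatory integrals whose phase has no stationary
points on the support of the amplitude. -/
theorem exists_pow_mul_norm_integral_oscFactor_le [Fintype ι] {e : ι → E} {v : ι → P × E → ℝ}
    {R : ℝ} {S : Set P} (hS : IsCompact S) (hψ : ContDiff ℝ ∞ ψ) (hv : ∀ j, ContDiff ℝ ∞ (v j))
    (hX : ∀ p ∈ S, ∀ x, ‖x‖ ≤ R → ∑ j, v j (p, x) * fderiv ℝ ψ (p, x) (0, e j) = 1) (k : ℕ)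
    {G : P × E → ℂ} (hG : ContDiff ℝ ∞ G) (hR : ∀ p x, R < ‖x‖ → G (p, x) = 0) :
    ∃ C : ℝ, ∀ p ∈ S, ∀ lam : ℝ,
      |lam| ^ k * ‖∫ x, G (p, x) * oscFactor ψ lam (p, x) ∂μ‖ ≤ C := by
  -- Each integration by parts gains one power of `λ` and replaces `G` by `transposeField e v G`,
  -- again smooth and zero for `‖x‖ > R`.
  induction k generalizing G with
  | zero =>
    have := FiniteDimensional.proper ℝ E
    obtain ⟨M, hM⟩ := (hS.prod (isCompact_closedBall (0 : E) R)).exists_bound_of_continuousOn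
      hG.continuous.continuousOn
    refine ⟨M * μ.real (Metric.closedBall 0 R), fun p hp lam => ?_⟩
    rw [pow_zero, one_mul, ← setIntegral_eq_integral_of_forall_compl_eq_zero
      (s := Metric.closedBall (0 : E) R)]
    · refine norm_setIntegral_le_of_norm_le_const measure_closedBall_lt_top fun x hx => ?_
      rw [norm_mul, norm_oscFactor, mul_one]
      exact hM (p, x) ⟨hp, hx⟩
    · intro x hx
      rw [hR p x (by simpa using hx), zero_mul]
  | succ k ih =>
    obtain ⟨C, hC⟩ := ih (contDiff_transposeField e hv hG) (transposeField_eq_zero e v hR)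
    refine ⟨C, fun p hp lam => ?_⟩
    have h := hC p hp lam
    rw [← I_mul_integral_mul_oscFactor μ hψ hv (hX p hp) hG hR, norm_mul, norm_mul,
      Complex.norm_I, one_mul, Complex.norm_real, Real.norm_eq_abs, ← mul_assoc, ← pow_succ] at h
    exact h

theorem continuous_integral_oscFactor [FiniteDimensional ℝ P] {R : ℝ} (hψ : Continuous ψ)
    {G : P × E → ℂ} (hG : Continuous G) (hR : ∀ p x, R < ‖x‖ → G (p, x) = 0) :
    Continuous fun q : ℝ × P => ∫ x, G (q.2, x) * oscFactor ψ q.1 (q.2, x) ∂μ := by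
  have := FiniteDimensional.proper ℝ E
  have := FiniteDimensional.proper ℝ P
  have h : (fun q : ℝ × P => ∫ x, G (q.2, x) * oscFactor ψ q.1 (q.2, x) ∂μ) =
      fun q => ∫ x in Metric.closedBall (0 : E) R, G (q.2, x) * oscFactor ψ q.1 (q.2, x) ∂μ := by
    funext q
    refine (setIntegral_eq_integral_of_forall_compl_eq_zero fun x hx => ?_).symm
    rw [hR q.2 x (by simpa using hx), zero_mul]
  rw [h]
  refine continuous_parametric_integral_of_continuous (f := fun (q : ℝ × P) x =>
    G (q.2, x) * oscFactor ψ q.1 (q.2, x)) ?_ (isCompact_closedBall 0 R)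
  unfold Function.uncurry oscFactor
  fun_prop

end OscillatoryIntegral

/-! ### The phase of the plane wave and its vector field. -/

/-- A smooth function which agrees with `F` on `[δ/2, ∞)` and vanishes on `(-∞, δ/4]`. -/
noncomputable def cutoffMul (δ : ℝ) (F : ℝ → ℝ) (t : ℝ) : ℝ :=
  Real.smoothTransition (4 / δ * t - 1) * F t

theorem cutoffMul_eq {δ : ℝ} (hδ : 0 < δ) (F : ℝ → ℝ) {t : ℝ} (ht : δ / 2 ≤ t) :
    cutoffMul δ F t = F t := by
  rw [cutoffMul, Real.smoothTransition.one_of_one_le, one_mul]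
  have : 4 / δ * (δ / 2) ≤ 4 / δ * t := mul_le_mul_of_nonneg_left ht (by positivity)
  have h2 : 4 / δ * (δ / 2) = 2 := by field_simp; norm_num
  linarith

theorem contDiff_cutoffMul {δ : ℝ} (hδ : 0 < δ) {F : ℝ → ℝ} (hF : ∀ t ≠ 0, ContDiffAt ℝ ∞ F t) :
    ContDiff ℝ ∞ (cutoffMul δ F) := by
  rw [contDiff_iff_contDiffAt]
  intro t
  by_cases ht : t = 0
  · subst ht
    have hev : cutoffMul δ F =ᶠ[nhds 0] fun _ => 0 := by
      filter_upwards [eventually_lt_nhds (show (0 : ℝ) < δ / 4 by positivity)] with t ht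
      rw [cutoffMul, Real.smoothTransition.zero_of_nonpos, zero_mul]
      have : 4 / δ * t ≤ 4 / δ * (δ / 4) := mul_le_mul_of_nonneg_left ht.le (by positivity)
      have h2 : 4 / δ * (δ / 4) = 1 := by field_simp
      linarith
    exact contDiffAt_const.congr_of_eventuallyEq hev
  · have h1 : ContDiff ℝ ∞ fun t : ℝ => Real.smoothTransition (4 / δ * t - 1) :=
      Real.smoothTransition.contDiff.comp (by fun_prop)
    exact h1.contDiffAt.mul (hF t ht)

theorem contDiff_cutoffMul_log {δ : ℝ} (hδ : 0 < δ) : ContDiff ℝ ∞ (cutoffMul δ Real.log) :=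
  contDiff_cutoffMul hδ fun _ ht => Real.contDiffAt_log.2 ht

theorem contDiff_cutoffMul_inv {δ : ℝ} (hδ : 0 < δ) :
    ContDiff ℝ ∞ (cutoffMul δ fun t => t⁻¹) :=
  contDiff_cutoffMul hδ fun _ ht => contDiffAt_inv ℝ ht

/-- Agreement with `log` down to `δ/2` leaves room for a neighbourhood of `t = δ`. -/
theorem hasDerivAt_cutoffMul_log {δ t : ℝ} (hδ : 0 < δ) (ht : δ ≤ t) :
    HasDerivAt (cutoffMul δ Real.log) t⁻¹ t := by
  refine (Real.hasDerivAt_log (by linarith : t ≠ 0)).congr_of_eventuallyEq ?_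
  filter_upwards [eventually_gt_nhds (show δ / 2 < t by linarith)] with s hs
  exact cutoffMul_eq hδ _ hs.le

section Phase

variable {n : ℕ}

/-- A globally smooth function which agrees with `log ((1 - |x|²) / |x - ζ|²)` when
`1 - |x|²` and `|x - ζ|²` are at least `δ`. -/
noncomputable def wavePhase (δ : ℝ)
    (q : EuclideanSpace ℝ (Fin n) × EuclideanSpace ℝ (Fin n)) : ℝ :=
  cutoffMul δ Real.log (1 - ‖q.2‖ ^ 2) - cutoffMul δ Real.log (‖q.2 - q.1‖ ^ 2)

/-- The components of `(1 - |x|²) / (2 (1 - x · ζ)) • (ζ - x)`, a vector field along which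
the phase has derivative one. -/
noncomputable def waveField (δ : ℝ) (j : Fin n)
    (q : EuclideanSpace ℝ (Fin n) × EuclideanSpace ℝ (Fin n)) : ℝ :=
  (1 - ‖q.2‖ ^ 2) / 2 * cutoffMul δ (fun t => t⁻¹) (1 - inner ℝ q.2 q.1) * (q.1 j - q.2 j)

theorem contDiff_wavePhase {δ : ℝ} (hδ : 0 < δ) : ContDiff ℝ ∞ (wavePhase (n := n) δ) := by
  refine ((contDiff_cutoffMul_log hδ).comp ?_).sub ((contDiff_cutoffMul_log hδ).comp ?_)
  · exact contDiff_const.sub (contDiff_snd.norm_sq ℝ)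
  · exact (contDiff_snd.sub contDiff_fst).norm_sq ℝ

theorem contDiff_waveField {δ : ℝ} (hδ : 0 < δ) (j : Fin n) : ContDiff ℝ ∞ (waveField δ j) := by
  have hp : ∀ i : Fin n, ContDiff ℝ ∞ fun x : EuclideanSpace ℝ (Fin n) => x i := fun i =>
    (EuclideanSpace.proj (𝕜 := ℝ) i).contDiff
  refine ((ContDiff.div_const (contDiff_const.sub (contDiff_snd.norm_sq ℝ)) 2).mul
    ((contDiff_cutoffMul_inv hδ).comp ?_)).mul
    (((hp j).comp contDiff_fst).sub ((hp j).comp contDiff_snd))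
  exact contDiff_const.sub (contDiff_snd.inner ℝ contDiff_fst)

/-- One value `δ = (1 - R)²` makes every cutoff inactive on `‖x‖ ≤ R`. -/
theorem le_of_mem_sphere_of_norm_le {R : ℝ} (hR : R < 1) {ζ x : EuclideanSpace ℝ (Fin n)}
    (hζ : ‖ζ‖ = 1) (hx : ‖x‖ ≤ R) :
    (1 - R) ^ 2 ≤ 1 - ‖x‖ ^ 2 ∧ (1 - R) ^ 2 ≤ ‖x - ζ‖ ^ 2 ∧ (1 - R) ^ 2 ≤ 1 - inner ℝ x ζ := by
  have h0 := norm_nonneg x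
  refine ⟨by nlinarith, ?_, ?_⟩
  · refine pow_le_pow_left₀ (by linarith) ?_ 2
    have := norm_sub_norm_le ζ x
    rw [norm_sub_rev] at this
    linarith
  · have := real_inner_le_norm x ζ
    rw [hζ, mul_one] at this
    nlinarith

/-- In the direction `ζ - x` the phase has derivative `-2 x·(ζ-x)/(1-|x|²) + 2 = 2(1 -
x·ζ)/(1-|x|²)`, the inverse of the factor in `waveField`. -/
theorem sum_waveField_mul_fderiv_wavePhase {R : ℝ} (hR : R < 1) {ζ x : EuclideanSpace ℝ (Fin n)}
    (hζ : ‖ζ‖ = 1) (hx : ‖x‖ ≤ R) :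
    ∑ j, waveField ((1 - R) ^ 2) j (ζ, x) * fderiv ℝ (wavePhase ((1 - R) ^ 2)) (ζ, x)
      (0, EuclideanSpace.single j 1) = 1 := by
  obtain ⟨h1, h2, h3⟩ := le_of_mem_sphere_of_norm_le hR hζ hx
  set δ := (1 - R) ^ 2
  have hδ : 0 < δ := by have : 0 < 1 - R := by linarith
                        positivity
  have hlin : ∑ j, (ζ j - x j) • (EuclideanSpace.single j 1 : EuclideanSpace ℝ (Fin n)) =
      ζ - x := by
    have := (EuclideanSpace.basisFun (Fin n) ℝ).sum_repr (ζ - x)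
    simpa using this
  have hsum : ∑ j, waveField δ j (ζ, x) * fderiv ℝ (wavePhase δ) (ζ, x)
      (0, EuclideanSpace.single j 1) =
      (1 - ‖x‖ ^ 2) / 2 * (1 - inner ℝ x ζ)⁻¹ * fderiv ℝ (wavePhase δ) (ζ, x) (0, ζ - x) := by
    have h4 : ((0 : EuclideanSpace ℝ (Fin n)), ζ - x) =
        ∑ j, (ζ j - x j) • ((0 : EuclideanSpace ℝ (Fin n)),
          (EuclideanSpace.single j 1 : EuclideanSpace ℝ (Fin n))) := by
      rw [← hlin]
      simp [Prod.ext_iff, Prod.fst_sum, Prod.snd_sum]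
    rw [h4, map_sum, Finset.mul_sum]
    refine Finset.sum_congr rfl fun j _ => ?_
    rw [map_smul, smul_eq_mul, waveField, cutoffMul_eq hδ _ (by linarith)]
    ring
  have hline : HasDerivAt (fun t : ℝ => x + t • (ζ - x)) (ζ - x) 0 := by
    simpa using ((hasDerivAt_id (0 : ℝ)).smul_const (ζ - x)).const_add x
  -- The directional derivative is identified by differentiating along this line in two ways.
  have hA : HasDerivAt (fun t : ℝ => wavePhase δ (ζ, x + t • (ζ - x)))
      (fderiv ℝ (wavePhase δ) (ζ, x) (0, ζ - x)) 0 := by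
    have hd := ((contDiff_wavePhase (n := n) hδ).differentiable (by simp) (ζ, x)).hasFDerivAt
    have hc : HasDerivAt (fun t : ℝ => (ζ, x + t • (ζ - x))) (0, ζ - x) 0 :=
      (hasDerivAt_const (0 : ℝ) ζ).prodMk hline
    exact HasFDerivAt.comp_hasDerivAt_of_eq 0 hd hc (by simp)
  have hB : HasDerivAt (fun t : ℝ => wavePhase δ (ζ, x + t • (ζ - x)))
      ((1 - ‖x‖ ^ 2)⁻¹ * (-(2 * inner ℝ x (ζ - x))) -
        (‖x - ζ‖ ^ 2)⁻¹ * (2 * inner ℝ (x - ζ) (ζ - x))) 0 := by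
    have l1 := hline.norm_sq.const_sub 1
    have l2 := (hline.sub_const ζ).norm_sq
    have e1 := HasDerivAt.comp_of_eq (0 : ℝ) (hasDerivAt_cutoffMul_log hδ h1) l1 (by simp)
    have e2 := HasDerivAt.comp_of_eq (0 : ℝ) (hasDerivAt_cutoffMul_log hδ h2) l2 (by simp)
    refine HasDerivAt.congr_deriv (e1.sub e2) ?_
    simp
  rw [hsum, hA.unique hB, inner_sub_right x ζ x, real_inner_self_eq_norm_sq,
    show ζ - x = -(x - ζ) by abel, inner_neg_right, real_inner_self_eq_norm_sq]
  have n1 : 1 - ‖x‖ ^ 2 ≠ 0 := by linarith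
  have n2 : ‖x - ζ‖ ≠ 0 := fun h => by rw [h] at h2; linarith
  have n3 : 1 - inner ℝ x ζ ≠ 0 := by linarith
  field_simp
  ring

end Phase

/-! ### Decay of the Helgason–Fourier transform and absolute convergence. -/

section Transform

variable {n : ℕ}

/-- The amplitude of the Helgason-Fourier transform as an oscillatory integral. -/
noncomputable def waveAmplitude (δ : ℝ) (f : EuclideanSpace ℝ (Fin n) → ℂ)
    (q : EuclideanSpace ℝ (Fin n) × EuclideanSpace ℝ (Fin n)) : ℂ :=
  f q.2 * (((2 * cutoffMul δ (fun t => t⁻¹) (1 - ‖q.2‖ ^ 2)) ^ n *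
    Real.exp (((n : ℝ) - 1) / 2 * wavePhase δ q) : ℝ) : ℂ)

theorem contDiff_waveAmplitude {δ : ℝ} (hδ : 0 < δ) {f : EuclideanSpace ℝ (Fin n) → ℂ}
    (hf : ContDiff ℝ ∞ f) : ContDiff ℝ ∞ (waveAmplitude δ f) := by
  refine contDiff_mul_ofReal (hf.comp contDiff_snd) (ContDiff.mul ?_ ?_)
  · exact (contDiff_const.mul ((contDiff_cutoffMul_inv hδ).comp
      (contDiff_const.sub (contDiff_snd.norm_sq ℝ)))).pow n
  · exact (contDiff_const.mul (contDiff_wavePhase hδ)).exp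

theorem IsTestFunction.exists_radius {f : EuclideanSpace ℝ (Fin n) → ℂ} (hf : IsTestFunction n f) :
    ∃ R < 1, ∀ x, R < ‖x‖ → f x = 0 := by
  obtain ⟨R, hR, hsub⟩ := exists_lt_subset_ball (isClosed_tsupport f) hf.support_subset
  refine ⟨R, hR, fun x hx => ?_⟩
  by_contra h
  have := hsub (subset_tsupport f h)
  rw [mem_ball_zero_iff] at this
  linarith

/-- Where `f` is nonzero, `e_{-λ,ζ} = exp((n-1)/2 · ψ) exp(-iλψ)`; the first factor and the volume
density go into the amplitude. -/
theorem helgasonFourier_eq_integral_oscFactor {f : EuclideanSpace ℝ (Fin n) → ℂ} {R : ℝ}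
    (hR : R < 1) (hf : ∀ x, R < ‖x‖ → f x = 0) (lam : ℝ) {ζ : EuclideanSpace ℝ (Fin n)}
    (hζ : ‖ζ‖ = 1) :
    helgasonFourier n f lam ζ = ∫ x, waveAmplitude ((1 - R) ^ 2) f (ζ, x) *
      oscFactor (wavePhase ((1 - R) ^ 2)) lam (ζ, x) := by
  have hδ : 0 < (1 - R) ^ 2 := by have : 0 < 1 - R := by linarith
                                  positivity
  have hmeas : Measurable fun x : EuclideanSpace ℝ (Fin n) =>
      ENNReal.ofReal ((2 / (1 - ‖x‖ ^ 2)) ^ n) := by fun_prop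
  rw [helgasonFourier, hypVolume, integral_withDensity_eq_integral_toReal_smul hmeas
    (Filter.Eventually.of_forall fun _ => ENNReal.ofReal_lt_top),
    setIntegral_eq_integral_of_forall_compl_eq_zero]
  · refine integral_congr_ae (Filter.Eventually.of_forall fun x => ?_)
    by_cases hx : R < ‖x‖
    · simp [waveAmplitude, hf x hx]
    · obtain ⟨h1, h2, -⟩ := le_of_mem_sphere_of_norm_le hR hζ (not_lt.1 hx)
      have p1 : 0 < 1 - ‖x‖ ^ 2 := by linarith
      have p2 : 0 < ‖x - ζ‖ ^ 2 := by linarith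
      have hphase : wavePhase ((1 - R) ^ 2) (ζ, x) = Real.log ((1 - ‖x‖ ^ 2) / ‖x - ζ‖ ^ 2) := by
        rw [wavePhase, cutoffMul_eq hδ _ (by linarith), cutoffMul_eq hδ _ (by linarith),
          Real.log_div p1.ne' p2.ne']
      have hne : (((1 - ‖x‖ ^ 2) / ‖x - ζ‖ ^ 2 : ℝ) : ℂ) ≠ 0 :=
        Complex.ofReal_ne_zero.2 (div_pos p1 p2).ne'
      simp only [waveAmplitude, oscFactor, planeWave]
      rw [Complex.cpow_def_of_ne_zero hne, ← Complex.ofReal_log (div_pos p1 p2).le, ← hphase,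
        cutoffMul_eq hδ _ (by linarith), ENNReal.toReal_ofReal (by positivity),
        Complex.real_smul, ← div_eq_mul_inv, Complex.ofReal_mul, Complex.ofReal_exp,
        show ∀ a b c d : ℂ, a * (b * c) * d = b * (a * (c * d)) by intros; ring,
        ← Complex.exp_add]
      congr 4
      push_cast
      ring
  · intro x hx
    rw [hf x, zero_mul, smul_zero]
    rw [hypBall, mem_ball_zero_iff, not_lt] at hx
    linarith

theorem exists_pow_mul_norm_helgasonFourier_le {f : EuclideanSpace ℝ (Fin n) → ℂ}
    (hf : IsTestFunction n f) (k : ℕ) :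
    ∃ C : ℝ, ∀ ζ : EuclideanSpace ℝ (Fin n), ‖ζ‖ = 1 → ∀ lam : ℝ,
      |lam| ^ k * ‖helgasonFourier n f lam ζ‖ ≤ C := by
  obtain ⟨R, hR, hf0⟩ := hf.exists_radius
  have hδ : 0 < (1 - R) ^ 2 := by have : 0 < 1 - R := by linarith
                                  positivity
  obtain ⟨C, hC⟩ := exists_pow_mul_norm_integral_oscFactor_le (R := R)
    (volume : Measure (EuclideanSpace ℝ (Fin n)))
    (isCompact_sphere (0 : EuclideanSpace ℝ (Fin n)) 1) (contDiff_wavePhase hδ)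
    (contDiff_waveField hδ) (e := fun j => EuclideanSpace.single j 1)
    (fun ζ hζ x hx => sum_waveField_mul_fderiv_wavePhase hR (by simpa using hζ) hx) k
    (contDiff_waveAmplitude hδ hf.smooth) (fun ζ x hx => by simp [waveAmplitude, hf0 x hx])
  refine ⟨C, fun ζ hζ lam => ?_⟩
  rw [helgasonFourier_eq_integral_oscFactor hR hf0 lam hζ]
  exact hC ζ (by simpa using hζ) lam

theorem continuous_helgasonFourier {f : EuclideanSpace ℝ (Fin n) → ℂ} (hf : IsTestFunction n f) :
    Continuous fun p : ℝ × Metric.sphere (0 : EuclideanSpace ℝ (Fin n)) 1 =>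
      helgasonFourier n f p.1 p.2 := by
  obtain ⟨R, hR, hf0⟩ := hf.exists_radius
  have hδ : 0 < (1 - R) ^ 2 := by have : 0 < 1 - R := by linarith
                                  positivity
  have h := continuous_integral_oscFactor (R := R)
    (volume : Measure (EuclideanSpace ℝ (Fin n))) (contDiff_wavePhase (n := n) hδ).continuous
    (contDiff_waveAmplitude hδ hf.smooth).continuous
    (fun ζ x hx => by simp [waveAmplitude, hf0 x hx])
  refine (h.comp (continuous_fst.prodMk (continuous_subtype_val.comp continuous_snd))).congr fun p => ?_
  exact (helgasonFourier_eq_integral_oscFactor hR hf0 p.1 (by simp)).symm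

theorem waveRatio_pos {x ζ : EuclideanSpace ℝ (Fin n)} (hx : x ∈ hypBall n) (hζ : ‖ζ‖ = 1) :
    0 < (1 - ‖x‖ ^ 2) / ‖x - ζ‖ ^ 2 := by
  rw [hypBall, mem_ball_zero_iff] at hx
  obtain ⟨h1, h2, -⟩ := le_of_mem_sphere_of_norm_le hx hζ le_rfl
  have : 0 < (1 - ‖x‖) ^ 2 := by have : 0 < 1 - ‖x‖ := by linarith
                                 positivity
  exact div_pos (by linarith) (by linarith)

theorem continuous_planeWave {x : EuclideanSpace ℝ (Fin n)} (hx : x ∈ hypBall n) :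
    Continuous fun p : ℝ × Metric.sphere (0 : EuclideanSpace ℝ (Fin n)) 1 =>
      planeWave n p.1 p.2 x := by
  unfold planeWave
  refine Continuous.cpow ?_ (by fun_prop) fun p =>
    Complex.ofReal_mem_slitPlane.2 (waveRatio_pos hx (by simp))
  refine Complex.continuous_ofReal.comp (Continuous.div (by fun_prop) (by fun_prop) fun p h => ?_)
  have := waveRatio_pos hx (ζ := p.2) (by simp)
  rw [h, div_zero] at this
  exact this.false

/-- The modulus does not depend on `λ`, so compactness of the sphere at `λ = 0` suffices. -/
theorem exists_norm_planeWave_le {x : EuclideanSpace ℝ (Fin n)} (hx : x ∈ hypBall n) :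
    ∃ C : ℝ, ∀ p : ℝ × Metric.sphere (0 : EuclideanSpace ℝ (Fin n)) 1,
      ‖planeWave n p.1 p.2 x‖ ≤ C := by
  have hc := (continuous_planeWave hx).comp
    (by fun_prop : Continuous fun ζ : Metric.sphere (0 : EuclideanSpace ℝ (Fin n)) 1 =>
      ((0 : ℝ), ζ))
  obtain ⟨C, hC⟩ := isCompact_univ.exists_bound_of_continuousOn hc.continuousOn
  refine ⟨C, fun p => le_of_eq_of_le ?_ (hC p.2 trivial)⟩
  have hpos := waveRatio_pos hx (ζ := p.2) (by simp)
  simp [planeWave, Complex.norm_cpow_eq_rpow_re_of_pos hpos, -Complex.ofReal_div]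

theorem integrable_multiplierIntegrand (hn : 2 ≤ n) {m : ℝ → ℝ} (hm : Continuous m)
    (hm' : HasPolyGrowth m) {f : EuclideanSpace ℝ (Fin n) → ℂ} (hf : IsTestFunction n f)
    {x : EuclideanSpace ℝ (Fin n)} (hx : x ∈ hypBall n) :
    Integrable (multiplierIntegrand n m f x) (spectralMeasure n) := by
  have hc := continuous_inv_norm_harishChandraC_sq hn
  have hcont : Continuous (multiplierIntegrand n m f x) :=
    (((Complex.continuous_ofReal.comp (hm.comp continuous_fst)).mul
      (continuous_helgasonFourier hf)).mul (continuous_planeWave hx)).mul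
      (Complex.continuous_ofReal.comp (hc.comp continuous_fst))
  obtain ⟨A, N, hA, hAN⟩ := hm'.mul (hasPolyGrowth_inv_norm_harishChandraC_sq hn)
  obtain ⟨B, hB⟩ := exists_norm_planeWave_le hx
  obtain ⟨C₀, hC₀⟩ := exists_pow_mul_norm_helgasonFourier_le hf 0
  -- `N` powers absorb the symbol and the density; two more leave the integrable majorant `(1 +
  -- λ²)⁻¹`. The bound for `k = 0` handles small `λ`.
  obtain ⟨C₁, hC₁⟩ := exists_pow_mul_norm_helgasonFourier_le hf (N + 2)
  have hint : Integrable (fun p : ℝ × Metric.sphere (0 : EuclideanSpace ℝ (Fin n)) 1 =>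
      A * B * 2 ^ (N + 2 - 1) * (C₀ + C₁) * (1 + p.1 ^ 2)⁻¹) (spectralMeasure n) :=
    (integrable_inv_one_add_sq.comp_fst _).const_mul _
  refine hint.mono' hcont.aestronglyMeasurable (Filter.Eventually.of_forall fun p => ?_)
  have hB0 : 0 ≤ B := (norm_nonneg _).trans (hB p)
  have hζ : ‖(p.2 : EuclideanSpace ℝ (Fin n))‖ = 1 := by simp
  set F := ‖helgasonFourier n f p.1 p.2‖
  have hF0 : 0 ≤ F := norm_nonneg _
  have e0 := hC₀ p.2 hζ p.1
  have e1 := hC₁ p.2 hζ p.1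
  have hsq : 1 + p.1 ^ 2 ≤ (1 + |p.1|) ^ 2 := by
    nlinarith [abs_nonneg p.1, sq_abs p.1]
  have hdecay : (1 + |p.1|) ^ N * F ≤ 2 ^ (N + 2 - 1) * (C₀ + C₁) * (1 + p.1 ^ 2)⁻¹ := by
    rw [← div_eq_mul_inv, le_div_iff₀ (by positivity)]
    calc (1 + |p.1|) ^ N * F * (1 + p.1 ^ 2) ≤ (1 + |p.1|) ^ N * F * (1 + |p.1|) ^ 2 := by gcongr
      _ = (1 + |p.1|) ^ (N + 2) * F := by ring
      _ ≤ (2 ^ (N + 2 - 1) * (1 ^ (N + 2) + |p.1| ^ (N + 2))) * F := by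
        gcongr
        exact add_pow_le zero_le_one (abs_nonneg _) _
      _ = 2 ^ (N + 2 - 1) * (|p.1| ^ 0 * F + |p.1| ^ (N + 2) * F) := by ring
      _ ≤ _ := by gcongr
  calc ‖multiplierIntegrand n m f x p‖ =
        |m p.1 * (‖harishChandraC n p.1‖ ^ 2)⁻¹| * (F * ‖planeWave n p.1 p.2 x‖) := by
        rw [multiplierIntegrand, norm_mul, norm_mul, norm_mul, Complex.norm_real,
          Complex.norm_real, abs_mul, Real.norm_eq_abs, Real.norm_eq_abs]
        ring
    _ ≤ A * (1 + |p.1|) ^ N * (F * B) := by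
        have := hAN p.1
        have := hB p
        gcongr
    _ = A * B * ((1 + |p.1|) ^ N * F) := by ring
    _ ≤ A * B * (2 ^ (N + 2 - 1) * (C₀ + C₁) * (1 + p.1 ^ 2)⁻¹) := by gcongr
    _ = _ := by ring

end Transform

/-! ### The operator identity. -/

theorem corollary4p3 (n : ℕ) (hn : 2 ≤ n) (γ : ℝ) (hγ : 0 < γ) :
    (∀ lam : ℝ, gjmsSymbol γ lam =
      tildeGjmsSymbol γ lam + Real.sin (γ * Real.pi) / Real.pi * gammaSqSymbol γ lam) ∧
    ∀ f : EuclideanSpace ℝ (Fin n) → ℂ, IsTestFunction n f →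
      ∀ x ∈ hypBall n,
        Integrable (multiplierIntegrand n (gjmsSymbol γ) f x) (spectralMeasure n) ∧
        Integrable (multiplierIntegrand n (tildeGjmsSymbol γ) f x) (spectralMeasure n) ∧
        Integrable (multiplierIntegrand n (gammaSqSymbol γ) f x) (spectralMeasure n) ∧
        fractionalGJMS n γ f x = tildeGJMS n γ f x +
          ((Real.sin (γ * Real.pi) / Real.pi : ℝ) : ℂ) * gammaSqOperator n γ f x := by
  refine ⟨gjmsSymbol_eq hγ, fun f hf x hx => ?_⟩
  have h1 := integrable_multiplierIntegrand hn (continuous_tildeGjmsSymbol hγ)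
    (hasPolyGrowth_tildeGjmsSymbol hγ) hf hx
  have h2 := integrable_multiplierIntegrand hn (continuous_gammaSqSymbol hγ)
    (hasPolyGrowth_gammaSqSymbol hγ) hf hx
  -- The integrand is linear in the symbol, so integrability for `P_γ` comes from the other two
  -- operators.
  have h3 : multiplierIntegrand n (gjmsSymbol γ) f x = fun p =>
      multiplierIntegrand n (tildeGjmsSymbol γ) f x p +
        ((Real.sin (γ * Real.pi) / Real.pi : ℝ) : ℂ) *
          multiplierIntegrand n (gammaSqSymbol γ) f x p := by
    funext p
    simp only [multiplierIntegrand, gjmsSymbol_eq hγ]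
    push_cast
    ring
  refine ⟨?_, h1, h2, ?_⟩
  · rw [h3]
    exact h1.add (h2.const_mul _)
  · rw [fractionalGJMS, tildeGJMS, gammaSqOperator, spectralMultiplier, h3,
      integral_add h1 (h2.const_mul _), integral_const_mul]
    rfl
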